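/- **Model.** Let $q>1/2$. On a finite graph $G=(V,E)$, the ground truth $\theta$ is uniform on $\{0,1\}$, and each agent $v\in V$ receives a private signal $p_v\in\{0,1\}$; given $\theta$, the signals are independent and each equals $\theta$ with probability $q$. Given an ordering $\sigma$ of $V$ (a bijection $V\to\{1,\dots,|V|\}$), known to all agents together with $G$ and $q$, the agents decide one after the other: $v$ sees $p_v$ and the predictions of those of its neighbours that precede it in $\sigma$, and announces as its prediction $a_v$ the value of $\theta$ with the larger posterior probability given this information (in a tie, $a_v=p_v$). Put $\ell_\sigma(v)=\Pr(a_v=\theta)$, $L_\sigma(G)=\frac1{|V|}\sum_{v\in V}\ell_\sigma(v)$, and let $L(G)$ be the average of $L_\sigma(G)$ over all $|V|!$ orderings $\sigma$. A sequence of graphs $G_n$ whose orders tend to infinity achieves random-order asymptotic learning if $L(G_n)\to 1$ as $n\to\infty$. **Proposition.** For every $k\ge 1$ let $G'_k$ be a graph on $k$ vertices with an ordering $\sigma_k$ and a designated vertex $v_k$, such that $\ell_{\sigma_k}(v_k)\to 1$ as $k\to\infty$. For all large $n$ let $k=k(n)\geq 1$ be $\log\log n$, and $s=s(n)\le n$ be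 $\sqrt n$, each rounded up or down to a whole number. Take the complete graph $K_n$, choose $s$ distinct vertices $v^{(1)},\dots,v^{(s)}$ of it, and for each $i$ attach a new copy of $G'_k\setminus v_k$, these copies being pairwise disjoint and joined to the rest of the graph only through edges to $v^{(i)}$, so that the $i$-th copy together with $v^{(i)}$ in the role of $v_k$ induces $G'_k$. Call the resulting graph, which has $n+s(k-1)$ vertices, $G_{n}$. Then the sequence $(G_n)$ achieves random-order asymptotic learning: $L(G_n)\to 1$ as $n\to\infty$. -/

import Mathlib

open Filter Topology

noncomputable section

namespace SocialLearning

variable {V : Type*} [Fintype V] [DecidableEq V]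

/-- The probability of the world in which the ground truth is `θ` and the private signals are `p`:
`θ` is uniform on `{0, 1}` and, given `θ`, the signals are independent, each equal to `θ` with
probability `q`. -/
def worldProb (q : ℝ) (θ : Bool) (p : V → Bool) : ℝ :=
  1 / 2 * ∏ v, if p v = θ then q else 1 - q

open Classical in
/-- The probability that the ground truth is `θ` and the vector of private signals lies in `E`. -/
def jointProb (q : ℝ) (θ : Bool) (E : Set (V → Bool)) : ℝ :=
  ∑ p : V → Bool with p ∈ E, worldProb q θ p

/-- The prediction announced by agent `v` when the private signals are `p` and the agents decide in
the order given by the bijection `σ`. The information of `v` is its own signal together with the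
predictions of its neighbours that precede it, and `E` is the event that this information is what it
is under `p`; hence `jointProb q t E` is proportional to the posterior probability that the ground
truth is `t`. The agent predicts the more probable value, and its own private signal in the case of
a tie. -/
def action (G : SimpleGraph V) (q : ℝ) {m : ℕ} (σ : V ≃ Fin m) (v : V) (p : V → Bool) : Bool :=
  let E : Set (V → Bool) := {p' | p' v = p v ∧
    ∀ u : V, (_ : G.Adj u v ∧ σ u < σ v) → action G q σ u p' = action G q σ u p}
  if jointProb q false E < jointProb q true E then true
  else if jointProb q true E < jointProb q false E then false
  else p v
termination_by σ v

/-- The learning rate `ℓ_σ(v)`: the probability that `v` predicts the ground truth. -/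
def learningRate (G : SimpleGraph V) (q : ℝ) {m : ℕ} (σ : V ≃ Fin m) (v : V) : ℝ :=
  ∑ θ : Bool, jointProb q θ {p | action G q σ v p = θ}

/-- The learning rate `L_σ(G)` of a graph with a fixed ordering: the expected fraction of agents
that predict the ground truth. -/
def graphLearningRate (G : SimpleGraph V) (q : ℝ) {m : ℕ} (σ : V ≃ Fin m) : ℝ :=
  (∑ v, learningRate G q σ v) / Fintype.card V

/-- The random-order learning rate `L(G)`: the average of `L_σ(G)` over all orderings `σ`. -/
def randomLearningRate (G : SimpleGraph V) (q : ℝ) : ℝ :=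
  (∑ σ : V ≃ Fin (Fintype.card V), graphLearningRate G q σ) /
    Fintype.card (V ≃ Fin (Fintype.card V))

/-- Random-order asymptotic learning of a sequence of graphs. -/
def AchievesRandomOrderLearning {V : ℕ → Type*} [∀ n, Fintype (V n)] [∀ n, DecidableEq (V n)]
    (G : ∀ n, SimpleGraph (V n)) (q : ℝ) : Prop :=
  Tendsto (fun n => randomLearningRate (G n) q) atTop (𝓝 1)

/-- The vertices of the boosted complete graph: those of `K_n`, and `s` disjoint copies of the
vertex set `W` with the designated vertex `v` removed. -/
abbrev BoostedVertex {W : Type*} (v : W) (n s : ℕ) : Type _ :=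
  Fin n ⊕ Fin s × {u : W // u ≠ v}

/-- The complete graph `K_n` in which, for each `i : Fin s`, a copy of `H` is attached at the vertex
`S i`, which takes the role of the designated vertex `v` of `H` in the `i`-th copy. -/
def boostedGraph {W : Type*} (H : SimpleGraph W) (v : W) {n s : ℕ} (S : Fin s ↪ Fin n) :
    SimpleGraph (BoostedVertex v n s) where
  Adj
    | .inl a, .inl b => a ≠ b
    | .inl a, .inr (i, u) => a = S i ∧ H.Adj v u
    | .inr (i, u), .inl a => a = S i ∧ H.Adj v u
    | .inr (i, u), .inr (j, w) => i = j ∧ H.Adj u w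
  symm := ⟨by
    rintro (a | ⟨i, u⟩) (b | ⟨j, w⟩) h
    · exact Ne.symm h
    · exact h
    · exact h
    · exact ⟨h.1.symm, h.2.symm⟩⟩
  loopless := ⟨by
    rintro (a | ⟨i, u⟩) h
    · exact h rfl
    · exact H.loopless.irrefl _ h.2⟩

end SocialLearning

end

/-! Call a copy of `G'_k` good if its vertices come in the order `σ_k` and all lie among the first
`m = ⌊N/k⌋` of the `N` positions. One good copy suffices. The vertices of the copy other than
`v^(i)` have no neighbours outside it, so those preceding `v^(i)` act exactly as in `G'_k`. Hence
`v^(i)` can simulate `v_k`, and by optimality of the Bayes decision it succeeds at least as often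
(`learningRate_embedding_le`). Every clique vertex after position `m` sees `v^(i)` and could imitate
it (`learningRate_le_of_adj`). These are all but at most `sk + N/k` of the `N` vertices, a vanishing
fraction.

A good copy exists with high probability. A given copy is good with probability `C(m,k)/(N)_k`,
where `(N)_k` is the falling factorial, and this is at least `(2k²)^(-k)`
(`descFactorial_le_pow_mul_choose`). Goodness of two copies is negatively correlated, since they
compete for early positions (`choose_mul_descFactorial_le`). Chebyshev's inequality
(`card_none_mul_le`) thus bounds the probability of no good copy by `(2k²)^k / s`. For `k ≈ log log
n` the numerator is eventually at most `n^(1/4)`, while `s ≈ √n`. -/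

namespace SocialLearning

/-! ### Bayesian optimality, imitation and simulation -/

section Bayes

variable {V W : Type*} [Fintype V] [Fintype W]

theorem worldProb_nonneg {q : ℝ} (h0 : 0 ≤ q) (h1 : q ≤ 1) (θ : Bool) (p : V → Bool) :
    0 ≤ worldProb q θ p :=
  mul_nonneg (by norm_num) (Finset.prod_nonneg fun v _ => by split_ifs <;> linarith)

variable [DecidableEq V]

theorem sum_signal (q : ℝ) (θ : Bool) : ∑ b : Bool, (if b = θ then q else 1 - q) = 1 := by
  cases θ <;> simp

/-- The signals of a set of agents have the law they would have on their own. -/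
theorem sum_worldProb_comp_eq (q : ℝ) (θ : Bool) (e : W ↪ V) (r : W → Bool) :
    ∑ p : V → Bool with p ∘ e = r, worldProb q θ p = worldProb q θ r := by
  classical
  -- The event is a product set, free in the coordinates outside the range of `e`, so the sum of
  -- products factorises and each free coordinate contributes 1.
  have hset : (Finset.univ.filter fun p : V → Bool => p ∘ e = r) =
      Fintype.piFinset fun x => Finset.univ.filter fun b : Bool => ∀ w, e w = x → b = r w := by
    ext p
    simp only [Finset.mem_filter, Finset.mem_univ, true_and, Fintype.mem_piFinset, funext_iff,
      Function.comp_apply]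
    exact ⟨fun h x w hw => hw ▸ h w, fun h w => h _ w rfl⟩
  simp only [worldProb]
  rw [← Finset.mul_sum, hset, ← Finset.prod_univ_sum
    (fun x => Finset.univ.filter fun b : Bool => ∀ w, e w = x → b = r w)
    (fun _ b => if b = θ then q else 1 - q)]
  congr 1
  rw [← Finset.prod_subset (Finset.subset_univ (Finset.univ.map e)), Finset.prod_map]
  · refine Finset.prod_congr rfl fun w _ => ?_
    have : (Finset.univ.filter fun b : Bool => ∀ w', e w' = e w → b = r w') = {r w} := by
      ext b
      simp only [Finset.mem_filter, Finset.mem_univ, true_and, Finset.mem_singleton]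
      exact ⟨fun h => h w rfl, fun h w' hw' => e.injective hw' ▸ h⟩
    rw [this, Finset.sum_singleton]
  · intro x _ hx
    have : (Finset.univ.filter fun b : Bool => ∀ w, e w = x → b = r w) = Finset.univ :=
      Finset.filter_true_of_mem fun b _ w hw => (hx (by simp [← hw])).elim
    rw [this, sum_signal]

variable [DecidableEq W]

/-- The signal vectors under which agent `v` has the same information as under `p`. -/
def infoSet (G : SimpleGraph V) (q : ℝ) {m : ℕ} (σ : V ≃ Fin m) (v : V) (p : V → Bool) :
    Set (V → Bool) :=
  {p' | p' v = p v ∧ ∀ u : V, G.Adj u v ∧ σ u < σ v → action G q σ u p' = action G q σ u p}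

theorem action_eq (G : SimpleGraph V) (q : ℝ) {m : ℕ} (σ : V ≃ Fin m) (v : V) (p : V → Bool) :
    action G q σ v p =
      if jointProb q false (infoSet G q σ v p) < jointProb q true (infoSet G q σ v p) then true
      else if jointProb q true (infoSet G q σ v p) < jointProb q false (infoSet G q σ v p) then false
      else p v := by
  rw [action]
  rfl

theorem infoSet_congr {G : SimpleGraph V} {q : ℝ} {m : ℕ} {σ : V ≃ Fin m} {v : V}
    {p p' : V → Bool} (h : p' ∈ infoSet G q σ v p) :
    infoSet G q σ v p' = infoSet G q σ v p := by
  ext r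
  constructor
  · exact fun hr => ⟨hr.1.trans h.1, fun u hu => (hr.2 u hu).trans (h.2 u hu)⟩
  · exact fun hr => ⟨hr.1.trans h.1.symm, fun u hu => (hr.2 u hu).trans (h.2 u hu).symm⟩

theorem mem_infoSet_self (G : SimpleGraph V) (q : ℝ) {m : ℕ} (σ : V ≃ Fin m) (v : V)
    (p : V → Bool) : p ∈ infoSet G q σ v p :=
  ⟨rfl, fun _ _ => rfl⟩

theorem action_congr {G : SimpleGraph V} {q : ℝ} {m : ℕ} {σ : V ≃ Fin m} {v : V}
    {p p' : V → Bool} (h : p' ∈ infoSet G q σ v p) :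
    action G q σ v p' = action G q σ v p := by
  rw [action_eq, action_eq, infoSet_congr h, h.1]

theorem jointProb_infoSet_le (G : SimpleGraph V) (q : ℝ) {m : ℕ} (σ : V ≃ Fin m) (v : V)
    (p : V → Bool) (b : Bool) :
    jointProb q b (infoSet G q σ v p) ≤
      jointProb q (action G q σ v p) (infoSet G q σ v p) := by
  rw [action_eq]
  split_ifs with h1 h2
  · cases b
    · exact h1.le
    · exact le_rfl
  · cases b
    · exact le_rfl
    · exact h2.le
  · have h := le_antisymm (not_lt.1 h1) (not_lt.1 h2)
    cases b <;> cases p v <;> simp [h]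

/-- Writing a success probability as one sum over signal vectors lets predictors be compared
information set by information set. -/
theorem sum_jointProb_eq (q : ℝ) (g : (V → Bool) → Bool) :
    ∑ θ : Bool, jointProb q θ {p | g p = θ} = ∑ p, worldProb q (g p) p := by
  classical
  simp only [jointProb, Set.mem_ofPred_eq, Finset.sum_filter]
  rw [Finset.sum_comm]
  exact Finset.sum_congr rfl fun p _ => by simp

/-- No predictor that only uses the information of agent `v` beats the prediction of `v`. -/
theorem sum_worldProb_le_learningRate (G : SimpleGraph V) (q : ℝ) {m : ℕ} (σ : V ≃ Fin m) (v : V)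
    (g : (V → Bool) → Bool) (hg : ∀ p p', p' ∈ infoSet G q σ v p → g p' = g p) :
    ∑ p, worldProb q (g p) p ≤ learningRate G q σ v := by
  classical
  rw [learningRate, sum_jointProb_eq]
  -- The information sets partition the signal vectors. A predictor based on them is constant on
  -- each, so each part reduces to the choice of one bit, where the agent's is optimal.
  rw [← Finset.sum_fiberwise_of_maps_to (t := Finset.univ.image (infoSet G q σ v))
      (fun p hp => Finset.mem_image_of_mem _ hp),
    ← Finset.sum_fiberwise_of_maps_to (t := Finset.univ.image (infoSet G q σ v))
      (fun p hp => Finset.mem_image_of_mem _ hp)]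
  refine Finset.sum_le_sum fun E hE => ?_
  obtain ⟨p, -, rfl⟩ := Finset.mem_image.1 hE
  have hmem : ∀ p', infoSet G q σ v p' = infoSet G q σ v p ↔ p' ∈ infoSet G q σ v p :=
    fun p' => ⟨fun h => h ▸ mem_infoSet_self G q σ v p', infoSet_congr⟩
  have key : ∀ f : (V → Bool) → Bool, (∀ p', p' ∈ infoSet G q σ v p → f p' = f p) →
      ∑ p' with infoSet G q σ v p' = infoSet G q σ v p, worldProb q (f p') p' =
        jointProb q (f p) (infoSet G q σ v p) := by
    intro f hf
    rw [jointProb]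
    refine Finset.sum_congr (Finset.filter_congr fun p' _ => hmem p') fun p' hp' => ?_
    rw [hf p' (Finset.mem_filter.1 hp').2]
  rw [key g (hg p), key _ fun p' h => action_congr h]
  exact jointProb_infoSet_le G q σ v p _

/-- An agent does at least as well as any neighbour that precedes it. -/
theorem learningRate_le_of_adj (G : SimpleGraph V) (q : ℝ) {m : ℕ} (σ : V ≃ Fin m) {u v : V}
    (h : G.Adj u v) (hlt : σ u < σ v) : learningRate G q σ u ≤ learningRate G q σ v := by
  rw [learningRate, sum_jointProb_eq]
  exact sum_worldProb_le_learningRate G q σ v _ fun p p' hp => hp.2 u ⟨h, hlt⟩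

theorem sum_worldProb_comp (q : ℝ) (e : W ↪ V) (g : (W → Bool) → Bool) :
    ∑ p : V → Bool, worldProb q (g (p ∘ e)) p = ∑ r, worldProb q (g r) r := by
  classical
  rw [← Finset.sum_fiberwise (s := Finset.univ) (g := fun p : V → Bool => p ∘ e)]
  refine Finset.sum_congr rfl fun r _ => ?_
  rw [← sum_worldProb_comp_eq q (g r) e r]
  exact Finset.sum_congr rfl fun p hp => by rw [(Finset.mem_filter.1 hp).2]

theorem jointProb_comp (q : ℝ) (θ : Bool) (e : W ↪ V) (F : Set (W → Bool)) :
    jointProb q θ {p : V → Bool | p ∘ e ∈ F} = jointProb q θ F := by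
  classical
  simp only [jointProb, Finset.sum_filter, Set.mem_ofPred_eq]
  rw [← Finset.sum_fiberwise (s := Finset.univ) (g := fun p : V → Bool => p ∘ e)]
  refine Finset.sum_congr rfl fun r _ => ?_
  rw [← sum_worldProb_comp_eq q θ e r]
  by_cases hr : r ∈ F
  · rw [if_pos hr]
    exact Finset.sum_congr rfl fun p hp => by rw [(Finset.mem_filter.1 hp).2, if_pos hr]
  · rw [if_neg hr]
    exact Finset.sum_eq_zero fun p hp => by rw [(Finset.mem_filter.1 hp).2, if_neg hr]

theorem sum_worldProb (q : ℝ) (θ : Bool) : ∑ p : V → Bool, worldProb q θ p = 1 / 2 := by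
  have h := sum_worldProb_comp (V := V) q (Function.Embedding.ofIsEmpty (α := Empty)) fun _ => θ
  rw [h]
  simp [worldProb]

theorem learningRate_nonneg {q : ℝ} (h0 : 0 ≤ q) (h1 : q ≤ 1) (G : SimpleGraph V) {m : ℕ}
    (σ : V ≃ Fin m) (v : V) : 0 ≤ learningRate G q σ v := by
  rw [learningRate, sum_jointProb_eq]
  exact Finset.sum_nonneg fun p _ => worldProb_nonneg h0 h1 _ p

theorem learningRate_le_one {q : ℝ} (h0 : 0 ≤ q) (h1 : q ≤ 1) (G : SimpleGraph V) {m : ℕ}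
    (σ : V ≃ Fin m) (v : V) : learningRate G q σ v ≤ 1 := by
  rw [learningRate, sum_jointProb_eq]
  calc ∑ p, worldProb q (action G q σ v p) p
      ≤ ∑ p : V → Bool, (worldProb q true p + worldProb q false p) := by
        refine Finset.sum_le_sum fun p _ => ?_
        have ht := worldProb_nonneg h0 h1 true p
        have hf := worldProb_nonneg h0 h1 false p
        cases action G q σ v p <;> linarith
    _ = 1 := by rw [Finset.sum_add_distrib, sum_worldProb, sum_worldProb]; norm_num

/-- Agents whose preceding neighbours lie in an embedded copy of `H`, and are ordered as in `H`,
behave as in `H`. -/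
theorem action_embedding (G : SimpleGraph V) (H : SimpleGraph W) (q : ℝ) {m k : ℕ}
    (σ : V ≃ Fin m) (τ : W ≃ Fin k) (e : W ↪ V) (v : W)
    (hadj : ∀ a b, H.Adj a b ↔ G.Adj (e a) (e b))
    (hord : ∀ a b, τ a < τ b ↔ σ (e a) < σ (e b))
    (hnbr : ∀ u, u ≠ v → ∀ x, G.Adj x (e u) → ∃ a, e a = x)
    (u : W) (hu : τ u < τ v) (p : V → Bool) :
    action G q σ (e u) p = action H q τ u (p ∘ e) := by
  induction hj : τ u using WellFoundedLT.induction generalizing u p with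
  | ind j ih =>
    have huv : u ≠ v := fun h => absurd hu (by simp [h])
    have hinfo : infoSet G q σ (e u) p = {p' | p' ∘ e ∈ infoSet H q τ u (p ∘ e)} := by
      ext p'
      refine and_congr Iff.rfl ⟨fun h a ha => ?_, fun h x hx => ?_⟩
      · have hlt : τ a < τ v := ha.2.trans hu
        rw [← ih (τ a) (hj ▸ ha.2) a hlt p' rfl, ← ih (τ a) (hj ▸ ha.2) a hlt p rfl]
        exact h _ ⟨(hadj _ _).1 ha.1, (hord _ _).1 ha.2⟩
      · obtain ⟨a, rfl⟩ := hnbr u huv x hx.1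
        have ha := (hord _ _).2 hx.2
        have hlt : τ a < τ v := ha.trans hu
        rw [ih (τ a) (hj ▸ ha) a hlt p' rfl, ih (τ a) (hj ▸ ha) a hlt p rfl]
        exact h _ ⟨(hadj _ _).2 hx.1, ha⟩
    rw [action_eq, action_eq, hinfo, jointProb_comp, jointProb_comp]
    rfl

/-- Only an inequality, because `e v` may also have earlier neighbours outside the copy. It can
ignore them and play the action of `v` in `H`, which its information determines. -/
theorem learningRate_embedding_le (G : SimpleGraph V) (H : SimpleGraph W) (q : ℝ) {m k : ℕ}
    (σ : V ≃ Fin m) (τ : W ≃ Fin k) (e : W ↪ V) (v : W)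
    (hadj : ∀ a b, H.Adj a b ↔ G.Adj (e a) (e b))
    (hord : ∀ a b, τ a < τ b ↔ σ (e a) < σ (e b))
    (hnbr : ∀ u, u ≠ v → ∀ x, G.Adj x (e u) → ∃ a, e a = x) :
    learningRate H q τ v ≤ learningRate G q σ (e v) := by
  rw [learningRate, sum_jointProb_eq, ← sum_worldProb_comp q e]
  refine sum_worldProb_le_learningRate G q σ (e v) (fun p => action H q τ v (p ∘ e)) ?_
  intro p p' hp
  refine action_congr ⟨hp.1, fun a ha => ?_⟩
  rw [← action_embedding G H q σ τ e v hadj hord hnbr a ha.2,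
    ← action_embedding G H q σ τ e v hadj hord hnbr a ha.2]
  exact hp.2 _ ⟨(hadj _ _).1 ha.1, (hord _ _).1 ha.2⟩

end Bayes

/-! ### Random orderings and the second moment method -/

section Counting

/-- The restriction of a uniformly random bijection to a set of points is a uniformly random
embedding. -/
theorem card_filter_equiv_restrict {ι V F : Type*} [Fintype ι] [Fintype V] [Fintype F]
    [DecidableEq ι] [DecidableEq V] [DecidableEq F] (hVF : Fintype.card V = Fintype.card F)
    (e : ι ↪ V) (A : Finset (ι ↪ F)) :
    (Finset.univ.filter fun σ : V ≃ F => e.trans σ.toEmbedding ∈ A).card *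
      (Fintype.card F).descFactorial (Fintype.card ι) = A.card * Fintype.card (V ≃ F) := by
  classical
  have hfib : ∀ f g : ι ↪ F,
      (Finset.univ.filter fun σ : V ≃ F => e.trans σ.toEmbedding = f).card ≤
        (Finset.univ.filter fun σ : V ≃ F => e.trans σ.toEmbedding = g).card := by
    intro f g
    -- A permutation of the positions carrying `f` to `g`; composing with it injects the fibre over
    -- `f` into that over `g`, so all fibres have equal size.
    let π : Equiv.Perm F :=
      ((Equiv.ofInjective f f.injective).symm.trans
        (Equiv.ofInjective g g.injective)).extendSubtype
    have hπ : ∀ i, π (f i) = g i := by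
      intro i
      have h := Equiv.extendSubtype_apply_of_mem ((Equiv.ofInjective f f.injective).symm.trans
        (Equiv.ofInjective g g.injective)) (f i) (Set.mem_range_self i)
      refine h.trans ?_
      have : (⟨f i, Set.mem_range_self i⟩ : Set.range f) = Equiv.ofInjective f f.injective i := rfl
      rw [Equiv.trans_apply, this, Equiv.symm_apply_apply]
      rfl
    refine Finset.card_le_card_of_injOn (fun σ => σ.trans π) (fun σ hσ => ?_) fun σ _ σ' _ h => ?_
    · simp only [Finset.coe_filter, Finset.mem_univ, true_and, Set.mem_ofPred_eq] at hσ ⊢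
      subst hσ
      ext i
      exact hπ i
    · ext x
      exact π.injective (Equiv.congr_fun h x)
  have key : ∀ (B : Finset (ι ↪ F)) (f : ι ↪ F),
      (Finset.univ.filter fun σ : V ≃ F => e.trans σ.toEmbedding ∈ B).card =
        B.card * (Finset.univ.filter fun σ : V ≃ F => e.trans σ.toEmbedding = f).card := by
    intro B f
    rw [← smul_eq_mul, ← Finset.sum_const]
    refine (Finset.card_eq_sum_card_fiberwise (f := fun σ : V ≃ F => e.trans σ.toEmbedding) (t := B)
      (fun σ hσ => (Finset.mem_filter.1 hσ).2)).trans ?_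
    refine Finset.sum_congr rfl fun g hg => ?_
    refine (congrArg Finset.card ?_).trans (le_antisymm (hfib g f) (hfib f g))
    ext σ
    simp only [Finset.mem_filter, Finset.mem_univ, true_and, and_iff_right_iff_imp]
    rintro rfl
    exact hg
  let σ₀ : V ≃ F := Fintype.equivOfCardEq hVF
  have huniv := key Finset.univ (e.trans σ₀.toEmbedding)
  simp only [Finset.mem_univ, Finset.filter_true, Finset.card_univ] at huniv
  rw [key A (e.trans σ₀.toEmbedding), huniv, ← Fintype.card_embedding_eq]
  ring

/-- The embeddings of `W` into the first `m` positions that induce on `W` the order `τ`. -/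
def orderedInto {W : Type*} [Fintype W] {k : ℕ} (τ : W ≃ Fin k) (N m : ℕ) : Set (W ↪ Fin N) :=
  {f | (∀ a, (f a : ℕ) < m) ∧ ∀ a b, τ a < τ b ↔ f a < f b}

/-- A finite set of positions has only one increasing enumeration, so the order `τ` and the image
determine the embedding. -/
theorem orderedInto_map_injOn {W : Type*} [Fintype W] {k N m : ℕ} (τ : W ≃ Fin k) :
    Set.InjOn (fun f : W ↪ Fin N => Finset.univ.map f) (orderedInto τ N m) := by
  intro f hf g hg hfg
  replace hfg : Finset.univ.map f = Finset.univ.map g := hfg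
  have hW : Fintype.card W = k := by rw [Fintype.card_congr τ, Fintype.card_fin]
  have hmono : ∀ h ∈ orderedInto τ N m, StrictMono (fun j => h (τ.symm j)) := fun h hh i j hij =>
    (hh.2 _ _).1 (by simpa using hij)
  have hcard : (Finset.univ.map f).card = k := by rw [Finset.card_map, Finset.card_univ, hW]
  have h1 := Finset.orderEmbOfFin_unique hcard
    (f := fun j => f (τ.symm j)) (fun j => Finset.mem_map_of_mem f (Finset.mem_univ _))
    (hmono f hf)
  have h2 := Finset.orderEmbOfFin_unique hcard
    (f := fun j => g (τ.symm j))
    (fun j => by rw [hfg]; exact Finset.mem_map_of_mem g (Finset.mem_univ _)) (hmono g hg)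
  ext a
  have := congrFun (h1.trans h2.symm) (τ a)
  simpa using congrArg Fin.val this

open Classical in
theorem card_orderedInto {W : Type*} [Fintype W] {k N m : ℕ} (τ : W ≃ Fin k) (hm : m ≤ N) :
    (orderedInto τ N m).toFinset.card = m.choose k := by
  have hB : (Finset.univ.filter fun x : Fin N => (x : ℕ) < m).card = m := by
    rw [Fin.card_filter_val_lt, min_eq_right hm]
  have hW : Fintype.card W = k := by rw [Fintype.card_congr τ, Fintype.card_fin]
  conv_rhs => rw [← hB, ← Finset.card_powersetCard]
  refine Finset.card_bij (fun f _ => Finset.univ.map f) ?_ ?_ ?_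
  · intro f hf
    rw [Set.mem_toFinset] at hf
    rw [Finset.mem_powersetCard, Finset.card_map, Finset.card_univ, hW]
    refine ⟨fun x hx => ?_, rfl⟩
    obtain ⟨a, -, rfl⟩ := Finset.mem_map.1 hx
    exact Finset.mem_filter.2 ⟨Finset.mem_univ _, hf.1 a⟩
  · intro f hf g hg hfg
    rw [Set.mem_toFinset] at hf hg
    exact orderedInto_map_injOn τ hf hg hfg
  · intro T hT
    rw [Finset.mem_powersetCard] at hT
    let f := T.orderEmbOfFin hT.2
    refine ⟨τ.toEmbedding.trans f.toEmbedding, ?_, ?_⟩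
    · rw [Set.mem_toFinset]
      refine ⟨fun a => ?_, fun a b => ?_⟩
      · exact (Finset.mem_filter.1 (hT.1 (T.orderEmbOfFin_mem hT.2 (τ a)))).2
      · exact f.lt_iff_lt.symm
    · rw [← Finset.map_map, Finset.map_univ_equiv]
      exact Finset.coe_injective (by simp [f])

-- The two images are disjoint `k`-subsets of the first `m` positions and determine the pair; an
-- upper bound is all that the second moment needs.
open Classical in
theorem card_orderedInto_pair_le {W : Type*} [Fintype W] {k N m : ℕ} (τ : W ≃ Fin k)
    (hm : m ≤ N) :
    (Finset.univ.filter fun f : W ⊕ W ↪ Fin N =>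
      Function.Embedding.inl.trans f ∈ orderedInto τ N m ∧
      Function.Embedding.inr.trans f ∈ orderedInto τ N m).card ≤
      m.choose k * (m - k).choose k := by
  set B := Finset.univ.filter fun x : Fin N => (x : ℕ) < m with hBdef
  have hB : B.card = m := by
    rw [hBdef, Fin.card_filter_val_lt, min_eq_right hm]
  have hW : Fintype.card W = k := by rw [Fintype.card_congr τ, Fintype.card_fin]
  have hC : ((B.powersetCard k).sigma fun T => (B \ T).powersetCard k).card =
      m.choose k * (m - k).choose k := by
    rw [Finset.card_sigma, Finset.sum_congr rfl (g := fun _ => (m - k).choose k),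
      Finset.sum_const, smul_eq_mul, Finset.card_powersetCard, hB]
    intro T hT
    rw [Finset.mem_powersetCard] at hT
    rw [Finset.card_powersetCard, Finset.card_sdiff_of_subset hT.1, hB, hT.2]
  rw [← hC]
  refine Finset.card_le_card_of_injOn
    (fun f => ⟨Finset.univ.map (Function.Embedding.inl.trans f),
      Finset.univ.map (Function.Embedding.inr.trans f)⟩) ?_ ?_
  · intro f hf
    obtain ⟨h1, h2⟩ := (Finset.mem_filter.1 hf).2
    simp only [Finset.mem_coe, Finset.mem_sigma, Finset.mem_powersetCard, Finset.card_map,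
      Finset.card_univ, hW, and_true]
    refine ⟨fun x hx => ?_, fun x hx => ?_⟩
    · obtain ⟨a, -, rfl⟩ := Finset.mem_map.1 hx
      exact Finset.mem_filter.2 ⟨Finset.mem_univ _, h1.1 a⟩
    · obtain ⟨a, -, rfl⟩ := Finset.mem_map.1 hx
      refine Finset.mem_sdiff.2 ⟨Finset.mem_filter.2 ⟨Finset.mem_univ _, h2.1 a⟩, fun h => ?_⟩
      obtain ⟨b, -, hb⟩ := Finset.mem_map.1 h
      exact Sum.inl_ne_inr (f.injective hb)
  · intro f hf g hg hfg
    obtain ⟨hf1, hf2⟩ := (Finset.mem_filter.1 hf).2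
    obtain ⟨hg1, hg2⟩ := (Finset.mem_filter.1 hg).2
    simp only [Sigma.mk.injEq, heq_eq_eq] at hfg
    have h1 := orderedInto_map_injOn τ hf1 hg1 hfg.1
    have h2 := orderedInto_map_injOn τ hf2 hg2 hfg.2
    ext (a | a)
    · exact congrArg Fin.val (DFunLike.congr_fun h1 a)
    · exact congrArg Fin.val (DFunLike.congr_fun h2 a)

/-- Negative correlation: one copy placed early leaves a smaller proportion of early positions for
the next. The inequality holds factor by factor. -/
theorem choose_mul_descFactorial_le {k N m : ℕ} (hm : m ≤ N) (hk : k ≤ N) :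
    (m - k).choose k * N.descFactorial k ≤ m.choose k * (N - k).descFactorial k := by
  have h : (m - k).descFactorial k * N.descFactorial k ≤
      m.descFactorial k * (N - k).descFactorial k := by
    simp only [Nat.descFactorial_eq_prod_range, ← Finset.prod_mul_distrib]
    refine Finset.prod_le_prod' fun j hj => ?_
    have hj := Finset.mem_range.1 hj
    rcases le_or_gt (m - k) j with h | h
    · rw [Nat.sub_eq_zero_of_le h]
      simp
    · obtain ⟨a, rfl⟩ : ∃ a, m = a + k + j := ⟨m - k - j, by omega⟩
      obtain ⟨b, rfl⟩ : ∃ b, N = a + b + k + j := ⟨N - a - k - j, by omega⟩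
      have e1 : a + k + j - k - j = a := by omega
      have e2 : a + b + k + j - j = a + b + k := by omega
      have e3 : a + k + j - j = a + k := by omega
      have e4 : a + b + k + j - k - j = a + b := by omega
      rw [e1, e2, e3, e4]
      -- The two sides differ by exactly `k * b`.
      nlinarith [Nat.zero_le (k * b)]
  rw [Nat.descFactorial_eq_factorial_mul_choose (m - k),
    Nat.descFactorial_eq_factorial_mul_choose m, mul_assoc, mul_assoc] at h
  exact Nat.le_of_mul_le_mul_left h (Nat.factorial_pos k)

/-- The second moment method for pairwise negatively correlated events of equal probability. -/
theorem card_none_mul_le {Ω : Type*} [Fintype Ω] [DecidableEq Ω] {s : ℕ} (X : Fin s → Finset Ω)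
    (a : ℕ) (ha : ∀ i, (X i).card = a)
    (hab : ∀ i j, i ≠ j → (X i ∩ X j).card * Fintype.card Ω ≤ a ^ 2) :
    ((Finset.univ.filter fun ω => ∀ i, ω ∉ X i).card : ℝ) * (s * a) ≤ (Fintype.card Ω : ℝ) ^ 2 := by
  rcases (Nat.eq_zero_or_pos (s * a)) with h0 | hpos
  · have : (s : ℝ) * a = 0 := by exact_mod_cast h0
    rw [this, mul_zero]
    positivity
  have hpos' : (0 : ℝ) < s * a := by exact_mod_cast hpos
  set M : ℝ := (Fintype.card Ω : ℝ) with hM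
  have hMpos : 0 < M := by
    have hs : 0 < s := Nat.pos_of_mul_pos_right hpos
    have ha' : 0 < (X ⟨0, hs⟩).card := by
      rw [ha]
      exact Nat.pos_of_mul_pos_left hpos
    rw [hM]
    exact_mod_cast ha'.trans_le (Finset.card_le_univ _)
  let I : Fin s → Ω → ℝ := fun i ω => if ω ∈ X i then 1 else 0
  have hI : ∀ i, ∑ ω, I i ω = a := fun i => by simp [I, ha]
  have hII : ∀ i j, ∑ ω, I i ω * I j ω = (X i ∩ X j).card := fun i j => by
    simp only [I, ← ite_and, mul_ite, mul_one, mul_zero]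
    rw [Finset.sum_boole]
    congr 2
    ext ω
    simp [and_comm]
  have h1 : ∑ ω, ∑ i, I i ω = s * a := by
    rw [Finset.sum_comm]
    simp [hI]
  -- Off-diagonal pairs contribute at most what independence would give; the diagonal adds `M * (s *
  -- a)`.
  have h2 : M * ∑ ω, (∑ i, I i ω) ^ 2 ≤ M * (s * a) + (s * a) ^ 2 := by
    have : ∑ ω, (∑ i, I i ω) ^ 2 = ∑ i, ∑ j, ((X i ∩ X j).card : ℝ) := by
      simp only [sq, Finset.sum_mul_sum]
      rw [Finset.sum_comm]
      refine Finset.sum_congr rfl fun i _ => ?_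
      rw [Finset.sum_comm]
      exact Finset.sum_congr rfl fun j _ => hII i j
    rw [this]
    calc M * ∑ i, ∑ j, ((X i ∩ X j).card : ℝ)
        = ∑ i, ∑ j, ((X i ∩ X j).card : ℝ) * M := by simp only [← Finset.sum_mul]; ring
      _ ≤ ∑ i : Fin s, ∑ j : Fin s, ((if i = j then M * a else 0) + (a : ℝ) ^ 2) := by
        refine Finset.sum_le_sum fun i _ => Finset.sum_le_sum fun j _ => ?_
        by_cases hij : i = j
        · subst hij
          rw [if_pos rfl, Finset.inter_self, ha]
          nlinarith [sq_nonneg (a : ℝ)]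
        · rw [if_neg hij, zero_add]
          rw [hM]
          exact_mod_cast hab i j hij
      _ = M * (s * a) + (s * a) ^ 2 := by
        simp only [Finset.sum_add_distrib, Finset.sum_ite_eq, Finset.mem_univ, if_true,
          Finset.sum_const, Finset.card_univ, Fintype.card_fin, nsmul_eq_mul]
        ring
  -- Chebyshev, scaled by `M` to avoid division: where no event occurs, the deviation from the mean
  -- is the whole mean.
  have h3 : ((Finset.univ.filter fun ω => ∀ i, ω ∉ X i).card : ℝ) * (s * a) ^ 2 ≤
      ∑ ω, (M * (∑ i, I i ω) - s * a) ^ 2 := by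
    rw [← nsmul_eq_mul, ← Finset.sum_const]
    calc _ ≤ ∑ ω with ∀ i, ω ∉ X i, (M * (∑ i, I i ω) - s * a) ^ 2 := by
          refine Finset.sum_le_sum fun ω hω => ?_
          have : ∑ i, I i ω = 0 :=
            Finset.sum_eq_zero fun i _ => if_neg ((Finset.mem_filter.1 hω).2 i)
          rw [this]
          apply le_of_eq
          ring
      _ ≤ _ := Finset.sum_le_sum_of_subset_of_nonneg (Finset.filter_subset _ _)
          fun _ _ _ => sq_nonneg _
  have h4 : ∑ ω, (M * (∑ i, I i ω) - s * a) ^ 2 =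
      M * (M * ∑ ω, (∑ i, I i ω) ^ 2) - M * (s * a) ^ 2 := by
    have : ∀ ω, (M * (∑ i, I i ω) - s * a) ^ 2 =
        M ^ 2 * (∑ i, I i ω) ^ 2 - 2 * M * (s * a) * (∑ i, I i ω) + (s * a) ^ 2 := fun ω => by ring
    simp only [this, Finset.sum_add_distrib, Finset.sum_sub_distrib, ← Finset.mul_sum, h1,
      Finset.sum_const, Finset.card_univ, nsmul_eq_mul, ← hM]
    ring
  have h5 : ((Finset.univ.filter fun ω => ∀ i, ω ∉ X i).card : ℝ) * (s * a) ^ 2 ≤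
      M ^ 2 * (s * a) := by
    nlinarith [mul_le_mul_of_nonneg_left h2 hMpos.le]
  refine le_of_mul_le_mul_right ?_ hpos'
  linarith [h5]

/-- The probability that none of `s` disjoint copies of `W` is ordered by `τ` within the first `m`
positions. -/
theorem card_none_orderedInto_mul_le {V W : Type*} [Fintype V] [DecidableEq V] [Fintype W]
    [DecidableEq W] {k N m s : ℕ} (τ : W ≃ Fin k) (hV : Fintype.card V = N) (hm : m ≤ N)
    (hk : 2 * k ≤ N) (e : Fin s → W ↪ V) (he : ∀ i j, i ≠ j → ∀ a b, e i a ≠ e j b)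
    [DecidablePred fun σ : V ≃ Fin N => ∀ i, (e i).trans σ.toEmbedding ∉ orderedInto τ N m] :
    ((Finset.univ.filter fun σ : V ≃ Fin N =>
        ∀ i, (e i).trans σ.toEmbedding ∉ orderedInto τ N m).card : ℝ) * (s * m.choose k) ≤
      N.descFactorial k * Fintype.card (V ≃ Fin N) := by
  classical
  have hW : Fintype.card W = k := by rw [Fintype.card_congr τ, Fintype.card_fin]
  have hVN : Fintype.card V = Fintype.card (Fin N) := by rw [hV, Fintype.card_fin]
  have hDpos : 0 < N.descFactorial k := Nat.descFactorial_pos.2 (by omega)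
  have hDpos' : 0 < (N - k).descFactorial k := Nat.descFactorial_pos.2 (by omega)
  let X : Fin s → Finset (V ≃ Fin N) := fun i =>
    Finset.univ.filter fun σ => (e i).trans σ.toEmbedding ∈ orderedInto τ N m
  set M := Fintype.card (V ≃ Fin N) with hM
  have hX : ∀ i, (X i).card * N.descFactorial k = m.choose k * M := by
    intro i
    have h := card_filter_equiv_restrict hVN (e i) (orderedInto τ N m).toFinset
    rw [card_orderedInto τ hm, Fintype.card_fin, hW] at h
    simpa only [Set.mem_toFinset] using h
  rcases Nat.eq_zero_or_pos s with rfl | hs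
  · simp only [Nat.cast_zero, zero_mul, mul_zero]
    positivity
  obtain ⟨a, ha⟩ : ∃ a, a = (X ⟨0, hs⟩).card := ⟨_, rfl⟩
  have hXa : ∀ i, (X i).card = a := fun i =>
    Nat.eq_of_mul_eq_mul_right hDpos ((hX i).trans (ha ▸ (hX _).symm))
  have haD : a * N.descFactorial k = m.choose k * M := ha ▸ hX _
  have hXX : ∀ i j, i ≠ j → (X i ∩ X j).card * M ≤ a ^ 2 := by
    intro i j hij
    let e' : W ⊕ W ↪ V := ⟨Sum.elim (e i) (e j),
      (e i).injective.sumElim (e j).injective (he i j hij)⟩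
    have h := card_filter_equiv_restrict hVN e' (Finset.univ.filter fun f : W ⊕ W ↪ Fin N =>
      Function.Embedding.inl.trans f ∈ orderedInto τ N m ∧
      Function.Embedding.inr.trans f ∈ orderedInto τ N m)
    have hset : (Finset.univ.filter fun σ : V ≃ Fin N => e'.trans σ.toEmbedding ∈
        (Finset.univ.filter fun f : W ⊕ W ↪ Fin N =>
          Function.Embedding.inl.trans f ∈ orderedInto τ N m ∧
          Function.Embedding.inr.trans f ∈ orderedInto τ N m)) = X i ∩ X j := by
      ext σ
      simp only [X, Finset.mem_filter, Finset.mem_univ, true_and, Finset.mem_inter]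
      rfl
    rw [hset, Fintype.card_fin, Fintype.card_sum, hW,
      ← Nat.descFactorial_mul_descFactorial (Nat.le_add_left k k), Nat.add_sub_cancel] at h
    have hle := card_orderedInto_pair_le τ hm
    have hc := choose_mul_descFactorial_le hm (show k ≤ N by omega)
    refine Nat.le_of_mul_le_mul_right (c := (N - k).descFactorial k * N.descFactorial k ^ 2) ?_
      (by positivity)
    calc (X i ∩ X j).card * M * ((N - k).descFactorial k * N.descFactorial k ^ 2)
        = ((X i ∩ X j).card * ((N - k).descFactorial k * N.descFactorial k)) *
            (M * N.descFactorial k) := by ring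
      _ ≤ (m.choose k * (m - k).choose k * M) * (M * N.descFactorial k) := by
          rw [h]
          gcongr
      _ = m.choose k * M ^ 2 * ((m - k).choose k * N.descFactorial k) := by ring
      _ ≤ m.choose k * M ^ 2 * (m.choose k * (N - k).descFactorial k) := by gcongr
      _ = (m.choose k * M) ^ 2 * (N - k).descFactorial k := by ring
      _ = a ^ 2 * ((N - k).descFactorial k * N.descFactorial k ^ 2) := by rw [← haD]; ring
  have hmain := card_none_mul_le X a hXa hXX
  have hset : (Finset.univ.filter fun σ : V ≃ Fin N => ∀ i, σ ∉ X i) =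
      Finset.univ.filter fun σ : V ≃ Fin N =>
        ∀ i, (e i).trans σ.toEmbedding ∉ orderedInto τ N m := by
    ext σ
    simp [X]
  rw [hset, ← hM] at hmain
  have hMpos : (0 : ℝ) < M := by
    have : 0 < M := Fintype.card_pos_iff.2 ⟨Fintype.equivOfCardEq hVN⟩
    exact_mod_cast this
  have haD' : (a : ℝ) * N.descFactorial k = m.choose k * M := by exact_mod_cast haD
  refine le_of_mul_le_mul_right ?_ hMpos
  calc _ = ((Finset.univ.filter fun σ : V ≃ Fin N =>
        ∀ i, (e i).trans σ.toEmbedding ∉ orderedInto τ N m).card : ℝ) *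
          (s * (m.choose k * M)) := by ring
    _ = ((Finset.univ.filter fun σ : V ≃ Fin N =>
        ∀ i, (e i).trans σ.toEmbedding ∉ orderedInto τ N m).card : ℝ) * (s * a) *
          N.descFactorial k := by rw [← haD']; ring
    _ ≤ (M : ℝ) ^ 2 * N.descFactorial k := by gcongr
    _ = _ := by ring

end Counting

/-! ### Good copies in the boosted complete graph -/

section Boosted

variable {W : Type*} [DecidableEq W]

/-- The `i`-th copy of the attached graph in the boosted complete graph. -/
def copyEmbedding (v : W) {n s : ℕ} (S : Fin s ↪ Fin n) (i : Fin s) : W ↪ BoostedVertex v n s where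
  toFun a := if h : a = v then .inl (S i) else .inr (i, ⟨a, h⟩)
  inj' a b h := by
    by_cases ha : a = v <;> by_cases hb : b = v <;> simp_all

theorem copyEmbedding_self (v : W) {n s : ℕ} (S : Fin s ↪ Fin n) (i : Fin s) :
    copyEmbedding v S i v = .inl (S i) :=
  dif_pos rfl

theorem copyEmbedding_of_ne {v a : W} (h : a ≠ v) {n s : ℕ} (S : Fin s ↪ Fin n) (i : Fin s) :
    copyEmbedding v S i a = .inr (i, ⟨a, h⟩) :=
  dif_neg h

theorem copyEmbedding_ne (v : W) {n s : ℕ} (S : Fin s ↪ Fin n) (i j : Fin s) (hij : i ≠ j)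
    (a b : W) : copyEmbedding v S i a ≠ copyEmbedding v S j b := by
  by_cases ha : a = v <;> by_cases hb : b = v <;>
    simp [copyEmbedding, ha, hb, hij]

theorem boostedGraph_adj_copyEmbedding (H : SimpleGraph W) (v : W) {n s : ℕ} (S : Fin s ↪ Fin n)
    (i : Fin s) (a b : W) :
    H.Adj a b ↔ (boostedGraph H v S).Adj (copyEmbedding v S i a) (copyEmbedding v S i b) := by
  by_cases ha : a = v <;> by_cases hb : b = v
  · subst ha hb
    simp
  · subst ha
    rw [copyEmbedding_self, copyEmbedding_of_ne hb]
    simp [boostedGraph]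
  · subst hb
    rw [copyEmbedding_self, copyEmbedding_of_ne ha]
    simp [boostedGraph, H.adj_comm]
  · rw [copyEmbedding_of_ne ha, copyEmbedding_of_ne hb]
    simp [boostedGraph]

theorem exists_copyEmbedding_eq_of_adj (H : SimpleGraph W) (v : W) {n s : ℕ} (S : Fin s ↪ Fin n)
    (i : Fin s) (u : W) (hu : u ≠ v) (x : BoostedVertex v n s)
    (hx : (boostedGraph H v S).Adj x (copyEmbedding v S i u)) :
    ∃ a, copyEmbedding v S i a = x := by
  rw [copyEmbedding_of_ne hu] at hx
  rcases x with a | ⟨j, w⟩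
  · exact ⟨v, by rw [copyEmbedding_self, ← hx.1]⟩
  · exact ⟨w, by rw [copyEmbedding_of_ne w.2, ← hx.1]⟩

variable [Fintype W]

theorem card_boostedVertex (v : W) (n s : ℕ) :
    Fintype.card (BoostedVertex v n s) = n + s * (Fintype.card W - 1) := by
  rw [Fintype.card_sum, Fintype.card_prod, Fintype.card_fin, Fintype.card_fin,
    Fintype.card_subtype_compl, Fintype.card_subtype_eq]

/-- If some copy is ordered as `τ` among the first `m` positions, all later agents of the complete
graph do at least as well as `v` does in `H`. -/
theorem le_graphLearningRate_boostedGraph {q : ℝ} (h0 : 0 ≤ q) (h1 : q ≤ 1) (H : SimpleGraph W)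
    {k : ℕ} (τ : W ≃ Fin k) (v : W) {n s N m : ℕ} (S : Fin s ↪ Fin n)
    (σ : BoostedVertex v n s ≃ Fin N) (i : Fin s)
    (hσ : (copyEmbedding v S i).trans σ.toEmbedding ∈ orderedInto τ N m) :
    learningRate H q τ v * ((n : ℝ) - m) / Fintype.card (BoostedVertex v n s) ≤
      graphLearningRate (boostedGraph H v S) q σ := by
  classical
  set G := boostedGraph H v S
  rw [graphLearningRate]
  refine div_le_div_of_nonneg_right ?_ (Nat.cast_nonneg _)
  have hcopy : learningRate H q τ v ≤ learningRate G q σ (.inl (S i)) := by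
    have h := learningRate_embedding_le G H q σ τ (copyEmbedding v S i) v
      (boostedGraph_adj_copyEmbedding H v S i) hσ.2 (exists_copyEmbedding_eq_of_adj H v S i)
    rwa [copyEmbedding_self] at h
  have hpos : (σ (.inl (S i)) : ℕ) < m := by
    have h := hσ.1 v
    rwa [Function.Embedding.trans_apply, copyEmbedding_self] at h
  have hlate : ∀ a : Fin n, ¬ (σ (.inl a) : ℕ) < m →
      learningRate H q τ v ≤ learningRate G q σ (.inl a) := by
    intro a ha
    refine hcopy.trans (learningRate_le_of_adj G q σ ?_ ?_)
    · show S i ≠ a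
      rintro rfl
      exact ha hpos
    · exact Fin.lt_def.2 (by omega)
  have hcard : (n : ℝ) - m ≤
      ((Finset.univ.filter fun a : Fin n => ¬ (σ (.inl a) : ℕ) < m).card : ℝ) := by
    have h2 : (Finset.univ.filter fun a : Fin n => (σ (.inl a) : ℕ) < m).card ≤ m := by
      refine (Finset.card_le_card_of_injOn (t := Finset.range m)
        (fun a => (σ (.inl a) : ℕ)) ?_ ?_).trans_eq (Finset.card_range m)
      · intro a ha
        exact Finset.mem_coe.2 (Finset.mem_range.2 (Finset.mem_filter.1 ha).2)
      · intro a _ b _ hab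
        exact Sum.inl_injective (σ.injective (Fin.val_injective hab))
    have h3 := Finset.card_filter_add_card_filter_not (s := (Finset.univ : Finset (Fin n)))
      (fun a : Fin n => (σ (.inl a) : ℕ) < m)
    rw [Finset.card_univ, Fintype.card_fin] at h3
    have h4 : n ≤ (Finset.univ.filter fun a : Fin n => ¬ (σ (.inl a) : ℕ) < m).card + m := by
      omega
    have : (n : ℝ) ≤
        ((Finset.univ.filter fun a : Fin n => ¬ (σ (.inl a) : ℕ) < m).card : ℝ) + m := by
      exact_mod_cast h4
    linarith
  have hnn := learningRate_nonneg h0 h1 G σ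
  rw [Fintype.sum_sum_type]
  calc learningRate H q τ v * ((n : ℝ) - m)
      ≤ ((Finset.univ.filter fun a : Fin n => ¬ (σ (.inl a) : ℕ) < m).card : ℝ) *
          learningRate H q τ v := by
        rw [mul_comm]
        exact mul_le_mul_of_nonneg_right hcard (learningRate_nonneg h0 h1 H τ v)
    _ ≤ ∑ a : Fin n with ¬ (σ (.inl a) : ℕ) < m, learningRate G q σ (.inl a) := by
        rw [← nsmul_eq_mul]
        exact Finset.card_nsmul_le_sum _ _ _ fun a ha => hlate a (Finset.mem_filter.1 ha).2
    _ ≤ ∑ a : Fin n, learningRate G q σ (.inl a) :=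
        Finset.sum_le_sum_of_subset_of_nonneg (Finset.filter_subset _ _) fun a _ _ => hnn _
    _ ≤ _ := le_add_of_nonneg_right (Finset.sum_nonneg fun x _ => hnn _)

/-- Bounds the inverse probability that a given copy is good when `m = N / k`. -/
theorem descFactorial_le_pow_mul_choose {N k : ℕ} (hk : 0 < k) (hN : 2 * k ^ 2 ≤ N) :
    N.descFactorial k ≤ (2 * k ^ 2) ^ k * (N / k).choose k := by
  have h1 : N < k * (N / k + 1) := Nat.lt_mul_div_succ N hk
  -- Twice `k * (N / k + 1)` exceeds `2 * N`, and the subtracted `2 * k ^ 2` is at most `N`.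
  have h2 : N ≤ 2 * k * (N / k + 1 - k) := by
    rw [Nat.mul_sub]
    apply Nat.le_sub_of_add_le
    nlinarith
  calc N.descFactorial k ≤ N ^ k := Nat.descFactorial_le_pow N k
    _ ≤ (2 * k * (N / k + 1 - k)) ^ k := Nat.pow_le_pow_left h2 k
    _ = (2 * k) ^ k * (N / k + 1 - k) ^ k := mul_pow _ _ _
    _ ≤ (2 * k) ^ k * (N / k).descFactorial k :=
        Nat.mul_le_mul_left _ (Nat.pow_sub_le_descFactorial _ _)
    _ = (2 * k) ^ k * (k.factorial * (N / k).choose k) := by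
        rw [Nat.descFactorial_eq_factorial_mul_choose]
    _ ≤ (2 * k) ^ k * (k ^ k * (N / k).choose k) := by
        gcongr
        exact Nat.factorial_le_pow k
    _ = (2 * k ^ 2) ^ k * (N / k).choose k := by rw [← mul_assoc, ← mul_pow]; ring_nf

/-- The first factor bounds the probability of a good copy from below; the second is the guarantee
for orderings that have one. Other orderings are counted as 0. -/
theorem le_randomLearningRate_boostedGraph {q : ℝ} (h0 : 0 ≤ q) (h1 : q ≤ 1) (H : SimpleGraph W)
    {k : ℕ} (τ : W ≃ Fin k) (v : W) {n s : ℕ} (S : Fin s ↪ Fin n) (hs : 0 < s)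
    (hn : 2 * k ^ 2 ≤ n) :
    (1 - ((2 * k ^ 2) ^ k : ℝ) / s) * (learningRate H q τ v *
      ((n : ℝ) - (Fintype.card (BoostedVertex v n s) / k : ℕ)) /
        Fintype.card (BoostedVertex v n s)) ≤ randomLearningRate (boostedGraph H v S) q := by
  classical
  have hW : Fintype.card W = k := by rw [Fintype.card_congr τ, Fintype.card_fin]
  have hk : 0 < k := hW ▸ Fintype.card_pos_iff.2 ⟨v⟩
  have hsn : s ≤ n := by simpa using Fintype.card_le_of_embedding S
  have hcard : Fintype.card (BoostedVertex v n s) = n + s * (k - 1) := by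
    rw [card_boostedVertex, hW]
  obtain ⟨N, hN⟩ : ∃ N, N = Fintype.card (BoostedVertex v n s) := ⟨_, rfl⟩
  have hnN : n ≤ N := by rw [hN, hcard]; exact Nat.le_add_right _ _
  have hNnk : N ≤ n * k := by
    obtain ⟨l, rfl⟩ : ∃ l, k = l + 1 := ⟨k - 1, by omega⟩
    rw [hN, hcard, Nat.add_sub_cancel]
    nlinarith [Nat.mul_le_mul_right l hsn]
  have hmn : N / k ≤ n := Nat.div_le_of_le_mul (by rwa [mul_comm])
  have h2k : 2 * k ≤ N := le_trans (by nlinarith) (hn.trans hnN)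
  have hmN : N / k ≤ N := Nat.div_le_self _ _
  rw [randomLearningRate, ← hN]
  set c : ℝ := learningRate H q τ v * ((n : ℝ) - (N / k : ℕ)) / N with hc
  have hc0 : 0 ≤ c := by
    have : (0 : ℝ) ≤ (n : ℝ) - (N / k : ℕ) := sub_nonneg.2 (by exact_mod_cast hmn)
    have h := learningRate_nonneg h0 h1 H τ v
    positivity
  let bad : (BoostedVertex v n s ≃ Fin N) → Prop := fun σ =>
    ∀ i, (copyEmbedding v S i).trans σ.toEmbedding ∉ orderedInto τ N (N / k)
  have hbad := card_none_orderedInto_mul_le τ hN.symm hmN h2k (copyEmbedding v S)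
    (copyEmbedding_ne v S)
  set z : ℝ := ((Finset.univ.filter bad).card : ℝ) with hz
  set M : ℝ := (Fintype.card (BoostedVertex v n s ≃ Fin N) : ℝ) with hM
  have hMpos : 0 < M := by
    have : 0 < Fintype.card (BoostedVertex v n s ≃ Fin N) :=
      Fintype.card_pos_iff.2 ⟨Fintype.equivOfCardEq (by rw [Fintype.card_fin, hN])⟩
    rw [hM]
    exact_mod_cast this
  have hspos : (0 : ℝ) < s := by exact_mod_cast hs
  have hD := descFactorial_le_pow_mul_choose hk (hn.trans hnN)
  have hDR : (N.descFactorial k : ℝ) ≤ (2 * k ^ 2) ^ k * (N / k).choose k := by exact_mod_cast hD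
  have hCpos : (0 : ℝ) < (N / k).choose k := by
    have : 0 < N.descFactorial k := Nat.descFactorial_pos.2 (by omega)
    have : 0 < (N / k).choose k := Nat.pos_of_mul_pos_left (this.trans_le hD)
    exact_mod_cast this
  have hzM : z ≤ (2 * k ^ 2) ^ k / s * M := by
    have : z * (s * (N / k).choose k) ≤ (2 * k ^ 2) ^ k * M * (N / k).choose k := by
      calc z * (s * (N / k).choose k) ≤ N.descFactorial k * M := hbad
        _ ≤ (2 * k ^ 2) ^ k * (N / k).choose k * M := by gcongr
        _ = _ := by ring
    rw [← mul_assoc] at this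
    have := le_of_mul_le_mul_right this hCpos
    rw [div_mul_eq_mul_div, le_div_iff₀ hspos]
    exact this
  rw [le_div_iff₀ hMpos]
  have hgood : ((Finset.univ.filter fun σ => ¬ bad σ).card : ℝ) = M - z := by
    have h := Finset.card_filter_add_card_filter_not
      (s := (Finset.univ : Finset (BoostedVertex v n s ≃ Fin N))) bad
    rw [Finset.card_univ] at h
    rw [hM, hz, ← h]
    push_cast
    ring
  have hnonneg : ∀ σ : BoostedVertex v n s ≃ Fin N,
      0 ≤ graphLearningRate (boostedGraph H v S) q σ := fun σ =>
    div_nonneg (Finset.sum_nonneg fun x _ => learningRate_nonneg h0 h1 _ σ x) (Nat.cast_nonneg _)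
  calc (1 - ((2 * k ^ 2) ^ k : ℝ) / s) * c * M
      = (M - (2 * k ^ 2) ^ k / s * M) * c := by ring
    _ ≤ (M - z) * c := by gcongr
    _ ≤ ∑ σ with ¬ bad σ, graphLearningRate (boostedGraph H v S) q σ := by
        rw [← hgood, ← nsmul_eq_mul]
        refine Finset.card_nsmul_le_sum _ _ _ fun σ hσ => ?_
        obtain ⟨i, hi⟩ := not_forall.1 (Finset.mem_filter.1 hσ).2
        have h := le_graphLearningRate_boostedGraph h0 h1 H τ v S σ i (not_not.1 hi)
        rwa [← hN] at h
    _ ≤ ∑ σ, graphLearningRate (boostedGraph H v S) q σ :=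
        Finset.sum_le_sum_of_subset_of_nonneg (Finset.filter_subset _ _) fun σ _ _ => hnonneg σ

theorem randomLearningRate_le_one {V : Type*} [Fintype V] [DecidableEq V] {q : ℝ} (h0 : 0 ≤ q)
    (h1 : q ≤ 1) (G : SimpleGraph V) : randomLearningRate G q ≤ 1 := by
  refine div_le_one_of_le₀ ?_ (Nat.cast_nonneg _)
  calc ∑ σ : V ≃ Fin (Fintype.card V), graphLearningRate G q σ
      ≤ ∑ _σ : V ≃ Fin (Fintype.card V), (1 : ℝ) := Finset.sum_le_sum fun σ _ => by
        refine div_le_one_of_le₀ ?_ (Nat.cast_nonneg _)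
        calc ∑ x, learningRate G q σ x ≤ ∑ _x : V, (1 : ℝ) :=
              Finset.sum_le_sum fun x _ => learningRate_le_one h0 h1 G σ x
          _ = Fintype.card V := by simp
    _ = _ := by simp

end Boosted

/-! ### Growth of `log log n` and `√n` -/

section Asymptotics

theorem two_mul_sq_pow_le_exp (k : ℕ) : ((2 * k ^ 2) ^ k : ℝ) ≤ Real.exp (2 * k ^ 3) := by
  calc ((2 * k ^ 2) ^ k : ℝ) ≤ Real.exp (2 * k ^ 2) ^ k := by
        gcongr
        linarith [Real.add_one_le_exp (2 * (k : ℝ) ^ 2)]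
    _ = Real.exp (2 * k ^ 3) := by rw [← Real.exp_nat_mul]; ring_nf

theorem tendsto_log_natCast : Tendsto (fun n : ℕ => Real.log n) atTop atTop :=
  Real.tendsto_log_atTop.comp tendsto_natCast_atTop_atTop

theorem eventually_cube_le_log {k : ℕ → ℕ}
    (hk : ∀ᶠ n : ℕ in atTop, |(k n : ℝ) - Real.log (Real.log (n : ℝ))| < 1) :
    ∀ᶠ n : ℕ in atTop, 2 * (k n : ℝ) ^ 3 ≤ Real.log n / 4 := by
  -- The constant 64 serves `2 * (2 * log x) ^ 3 = 16 * log x ^ 3 ≤ x / 4`, as eventually `k ≤ 2 *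
  -- log (log n)`.
  have hlog : ∀ᶠ x : ℝ in atTop, Real.log x ^ 3 ≤ x / 64 := by
    filter_upwards [(Real.isLittleO_pow_log_id_atTop (n := 3)).bound
      (show (0 : ℝ) < 1 / 64 by norm_num), eventually_ge_atTop 0] with x hx hx0
    rw [id, Real.norm_of_nonneg hx0] at hx
    linarith [Real.le_norm_self (Real.log x ^ 3)]
  filter_upwards [hk, tendsto_log_natCast.eventually hlog, tendsto_log_natCast.eventually
    (Real.tendsto_log_atTop.eventually_ge_atTop 1)] with n h1 h2 h3
  have h4 : (k n : ℝ) ≤ 2 * Real.log (Real.log n) := by linarith [(abs_lt.1 h1).2]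
  have h5 : (k n : ℝ) ^ 3 ≤ (2 * Real.log (Real.log n)) ^ 3 := by gcongr
  nlinarith

theorem tendsto_atTop_of_near_log_log {k : ℕ → ℕ+}
    (hk : ∀ᶠ n : ℕ in atTop, |((k n : ℕ) : ℝ) - Real.log (Real.log (n : ℝ))| < 1) :
    Tendsto k atTop atTop := by
  refine tendsto_atTop.2 fun b => ?_
  filter_upwards [hk, tendsto_log_natCast.eventually
    (Real.tendsto_log_atTop.eventually_ge_atTop ((b : ℕ) + 1 : ℝ))] with n h1 h2
  have : ((b : ℕ) : ℝ) ≤ ((k n : ℕ) : ℝ) := by linarith [(abs_lt.1 h1).1]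
  exact_mod_cast this

theorem eventually_near_sqrt {s : ℕ → ℕ}
    (hs : ∀ᶠ n : ℕ in atTop, |(s n : ℝ) - Real.sqrt (n : ℝ)| < 1) :
    ∀ᶠ n : ℕ in atTop, Real.exp (Real.log n / 2) / 2 ≤ s n ∧
      (s n : ℝ) ≤ 2 * Real.exp (Real.log n / 2) := by
  -- For `n ≥ 4` the root is at least 2, so an error below 1 costs at most a factor 2.
  filter_upwards [hs, eventually_ge_atTop 4] with n h1 h2
  have hn : (4 : ℝ) ≤ n := by exact_mod_cast h2
  have h3 : (2 : ℝ) ≤ Real.sqrt n := Real.le_sqrt_of_sq_le (by linarith)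
  rw [Real.exp_half, Real.exp_log (by linarith)]
  have := abs_lt.1 h1
  constructor <;> linarith

end Asymptotics

end SocialLearning

theorem mainTheorem3
    (q : ℝ) (hq : 1 / 2 < q) (hq' : q ≤ 1)
    -- the given network, with strategic orderings and designated vertices that learn
    (G' : ∀ k : ℕ+, SimpleGraph (Fin k))
    (σ : ∀ k : ℕ+, Fin k ≃ Fin k)
    (v : ∀ k : ℕ+, Fin k)
    (hv : Tendsto (fun k : ℕ+ => SocialLearning.learningRate (G' k) q (σ k) (v k)) atTop (𝓝 1))
    -- `log log n` and `√n`, rounded up or down to whole numbers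
    (k : ℕ → ℕ+)
    (hk : ∀ᶠ n : ℕ in atTop, |((k n : ℕ) : ℝ) - Real.log (Real.log (n : ℝ))| < 1)
    (s : ℕ → ℕ)
    (hs : ∀ᶠ n : ℕ in atTop, |(s n : ℝ) - Real.sqrt (n : ℝ)| < 1)
    -- the distinct vertices of the complete graph at which the copies are attached
    (S : ∀ n : ℕ, Fin (s n) ↪ Fin n) :
    SocialLearning.AchievesRandomOrderLearning
      (fun n => SocialLearning.boostedGraph (G' (k n)) (v (k n)) (S n)) q := by
  have h0 : 0 ≤ q := by linarith
  have hkTop : Tendsto k atTop atTop := SocialLearning.tendsto_atTop_of_near_log_log hk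
  have hkR : Tendsto (fun n => ((k n : ℕ) : ℝ)) atTop atTop := by
    refine tendsto_natCast_atTop_atTop.comp (tendsto_atTop.2 fun b => ?_)
    filter_upwards [hkTop.eventually_ge_atTop b.succPNat] with n hn
    exact (Nat.le_succ b).trans (by exact_mod_cast hn)
  have hε : Tendsto (fun n : ℕ => 2 * Real.exp (-(Real.log n / 4))) atTop (𝓝 0) := by
    have h := Real.tendsto_exp_neg_atTop_nhds_zero.comp
      (SocialLearning.tendsto_log_natCast.atTop_div_const (show (0 : ℝ) < 4 by norm_num))
    simpa using h.const_mul 2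
  -- The errors are, in turn, the chance of no good copy, the share of attached vertices, and the
  -- share `1/k` of early positions.
  have hlow : Tendsto (fun n : ℕ => (1 - 2 * Real.exp (-(Real.log n / 4))) *
      (SocialLearning.learningRate (G' (k n)) q (σ (k n)) (v (k n)) *
        (1 - 2 * Real.exp (-(Real.log n / 4)) - (((k n : ℕ) : ℝ))⁻¹))) atTop (𝓝 1) := by
    have h := (tendsto_const_nhds (x := (1 : ℝ)).sub hε).mul ((hv.comp hkTop).mul
      ((tendsto_const_nhds (x := (1 : ℝ)).sub hε).sub hkR.inv_tendsto_atTop))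
    simpa using h
  refine tendsto_of_tendsto_of_tendsto_of_le_of_le' hlow tendsto_const_nhds ?_
    (Eventually.of_forall fun n => SocialLearning.randomLearningRate_le_one h0 hq' _)
  filter_upwards [SocialLearning.eventually_cube_le_log hk, SocialLearning.eventually_near_sqrt hs,
    hε.eventually (eventually_lt_nhds zero_lt_one), eventually_ge_atTop 1] with n hcube hsn hεn hn1
  set K : ℕ := (k n : ℕ) with hK
  set x : ℝ := Real.log n with hx
  have hK1 : 1 ≤ K := (k n).pos
  have hK1R : (1 : ℝ) ≤ K := by exact_mod_cast hK1
  have hnpos : (0 : ℝ) < n := by exact_mod_cast hn1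
  have hnx : (n : ℝ) = Real.exp x := (Real.exp_log hnpos).symm
  have hspos : (0 : ℝ) < s n := lt_of_lt_of_le (by positivity) hsn.1
  have hr : ((2 * K ^ 2) ^ K : ℝ) / s n ≤ 2 * Real.exp (-(x / 4)) := by
    rw [div_le_iff₀ hspos]
    calc ((2 * K ^ 2) ^ K : ℝ) ≤ Real.exp (2 * K ^ 3) := SocialLearning.two_mul_sq_pow_le_exp K
      _ ≤ Real.exp (x / 4) := Real.exp_le_exp.2 hcube
      _ = 2 * Real.exp (-(x / 4)) * (Real.exp (x / 2) / 2) := by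
          rw [show x / 4 = -(x / 4) + x / 2 by ring, Real.exp_add]
          ring_nf
      _ ≤ 2 * Real.exp (-(x / 4)) * s n := by gcongr; exact hsn.1
  have hKx : (K : ℝ) ≤ Real.exp (x / 4) := by
    have h1 : (K : ℝ) ≤ 2 * K ^ 3 := by nlinarith [one_le_pow₀ hK1R (n := 2)]
    linarith [Real.add_one_le_exp (x / 4)]
  have hsK : (s n : ℝ) * K / n ≤ 2 * Real.exp (-(x / 4)) := by
    rw [div_le_iff₀ hnpos, hnx]
    calc (s n : ℝ) * K ≤ 2 * Real.exp (x / 2) * Real.exp (x / 4) := by gcongr; exact hsn.2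
      _ = 2 * Real.exp (-(x / 4)) * Real.exp x := by
          rw [mul_assoc, mul_assoc, ← Real.exp_add, ← Real.exp_add]
          ring_nf
  have hS : s n ≤ n := by simpa using Fintype.card_le_of_embedding (S n)
  -- The size condition comes for free: once the failure bound is below 1, `(2 * K ^ 2) ^ K ≤ s n ≤
  -- n`.
  have h2K : 2 * K ^ 2 ≤ n := by
    have h1 : ((2 * K ^ 2) ^ K : ℝ) ≤ s n := by
      have := hr.trans hεn.le
      rwa [div_le_one hspos] at this
    have h2 : (2 * K ^ 2) ^ K ≤ s n := by exact_mod_cast h1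
    exact (Nat.le_self_pow (by omega) _).trans (h2.trans hS)
  refine le_trans ?_ (SocialLearning.le_randomLearningRate_boostedGraph h0 hq' (G' (k n))
    (σ (k n)) (v (k n)) (S n) (by exact_mod_cast hspos) h2K)
  have hcard := SocialLearning.card_boostedVertex (v (k n)) n (s n)
  rw [Fintype.card_fin] at hcard
  obtain ⟨N, hN⟩ : ∃ N, N = Fintype.card (SocialLearning.BoostedVertex (v (k n)) n (s n)) :=
    ⟨_, rfl⟩
  rw [← hN] at hcard ⊢
  have hnN : n ≤ N := hcard ▸ Nat.le_add_right _ _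
  have hNpos : (0 : ℝ) < N := hnpos.trans_le (by exact_mod_cast hnN)
  have hNle : (N : ℝ) ≤ n + s n * K := by
    have : N ≤ n + s n * K := hcard ▸ by gcongr; omega
    exact_mod_cast this
  have hfrac : 1 - 2 * Real.exp (-(x / 4)) - (K : ℝ)⁻¹ ≤ ((n : ℝ) - (N / K : ℕ)) / N := by
    rw [sub_div]
    have h1 : 1 - (s n : ℝ) * K / n ≤ n / N := by
      rw [sub_le_comm, one_sub_div hNpos.ne']
      have : (N : ℝ) - n ≤ s n * K := by linarith
      have hn' : (n : ℝ) ≤ N := by exact_mod_cast hnN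
      gcongr
    have h2 : ((N / K : ℕ) : ℝ) / N ≤ (K : ℝ)⁻¹ := by
      rw [div_le_iff₀ hNpos, inv_mul_eq_div]
      exact Nat.cast_div_le
    linarith
  have hℓ := SocialLearning.learningRate_nonneg h0 hq' (G' (k n)) (σ (k n)) (v (k n))
  have hKN : (0 : ℝ) ≤ ((n : ℝ) - (N / K : ℕ)) / N := by
    refine div_nonneg (sub_nonneg.2 ?_) hNpos.le
    -- Since `s n ≤ n`, the graph has at most `n * K` vertices.
    have : N / K ≤ n := by
      refine Nat.div_le_of_le_mul ?_
      obtain ⟨l, hl⟩ : ∃ l, K = l + 1 := ⟨K - 1, by omega⟩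
      rw [hcard, ← hK, hl, Nat.add_sub_cancel]
      nlinarith [Nat.mul_le_mul_right l hS]
    exact_mod_cast this
  rw [mul_div_assoc]
  calc _ ≤ (1 - 2 * Real.exp (-(x / 4))) *
        (SocialLearning.learningRate (G' (k n)) q (σ (k n)) (v (k n)) *
          (((n : ℝ) - (N / K : ℕ)) / N)) :=
        mul_le_mul_of_nonneg_left (mul_le_mul_of_nonneg_left hfrac hℓ) (by linarith)
    _ ≤ _ := mul_le_mul_of_nonneg_right (by linarith) (mul_nonneg hℓ hKN)
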